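/- Let $X$ be a compact metrizable space that has a free interval, that is, a nonempty open subset homeomorphic to an open interval of the real line. Let $f\colon X\to X$ be a continuous map that is minimal, that is, for every $x\in X$ the orbit $\{f^k(x): k\ge 0\}$ is dense in $X$. Then there are an integer $n\ge 1$ and pairwise disjoint subsets $C_0,\dots,C_{n-1}$ of $X$, each open and closed in $X$ and each homeomorphic to the circle $\mathbb{R}/\mathbb{Z}$, such that $X=C_0\cup\dots\cup C_{n-1}$ and $f(C_i)=C_{i+1 \bmod n}$ for every $i$. Moreover, there is an irrational number $\alpha$ such that for every $i$ the restriction $f^n|_{C_i}\colon C_i\to C_i$ is topologically conjugate to the rotation $x\mapsto x+\alpha$ of $\mathbb{R}/\mathbb{Z}$. -/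

import Mathlib

open Set Function Topology

/-- A free interval of a space `X`: an open subset homeomorphic to a (nonempty) open interval
of the real line, bounded or not. -/
def IsFreeInterval {X : Type*} [TopologicalSpace X] (J : Set X) : Prop :=
  IsOpen J ∧ ∃ I : Set ℝ, I.Nonempty ∧ IsOpen I ∧ I.OrdConnected ∧ Nonempty (J ≃ₜ I)

/-- The map `f` is minimal: every (forward) orbit `{f^n x : n ≥ 0}` is dense. -/
def IsMinimalMap {X : Type*} [TopologicalSpace X] (f : X → X) : Prop :=
  ∀ x : X, Dense (range fun n : ℕ => f^[n] x)

/-- The self-maps `f` and `g` are topologically conjugate. -/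
def TopologicallyConjugate {X Y : Type*} [TopologicalSpace X] [TopologicalSpace Y]
    (f : X → X) (g : Y → Y) : Prop :=
  ∃ h : X ≃ₜ Y, Semiconj h f g

/-- The subset `C` of `X` is a circle, i.e. it is homeomorphic to the circle `ℝ / ℤ`. -/
def IsTopologicalCircle {X : Type*} [TopologicalSpace X] (C : Set X) : Prop :=
  Nonempty (C ≃ₜ UnitAddCircle)

/-- The rotation `x ↦ x + α` of the circle `ℝ / ℤ`. -/
def circleRotation (α : ℝ) (x : UnitAddCircle) : UnitAddCircle :=
  x + (α : UnitAddCircle)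

/-!
The dynamics forces `X` to be a one-dimensional manifold. A minimal map is irreducible: no proper
closed subset is mapped onto `X` (`IsMinimalMap.eq_univ_of_image_eq_univ`). If an iterate `f^k`
maps an arc of the free interval into that interval, it must therefore be injective on it, since
near a fold some open set could be removed from `X` without losing any value; and for the same
reason no point outside the arc has the same image as an interior point of it. As every point of
`X` is an image under some `f^j` of a point of the free interval, `f` is injective, hence a
homeomorphism (`IsMinimalMap.isHomeomorph`), and its iterates carry the free interval to a
neighbourhood of any given point.

A clopen circle is then found as a closed curve (`IsMinimalMap.exists_isClopen_circle`). Some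
`g = f^k` moves a point `φ 0` of the free interval to another one, `φ 1`. The arc between them
extends to a curve `γ : ℝ → X` with `γ (t + 1) = g (γ t)`. Absence of fixed points
makes `g` preserve the orientation at `φ 0`, so `γ` is locally injective. It is not injective, since
`g` would otherwise act on an open line by a translation, against recurrence. A shortest loop of `γ`
is an embedded circle, and it is open by invariance of domain in dimension one.

Being clopen and connected, the images of this circle under the iterates of `f` are equal or
disjoint, so they form a cycle of some length `n`, which is all of `X` by minimality
(`IsMinimalMap.exists_cycle`). Finally `f^n` is minimal on the circle, and a minimal injective
circle map is conjugate to an irrational rotation (`IsMinimalMap.exists_conjugate_rotation`): having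
no fixed point it has a lift of degree one, its rotation number is irrational as there are no
periodic points, and Poincaré's semiconjugacy to the rotation is a homeomorphism because it has
dense range and, by minimality, no interval of constancy.
-/

/-! ### Folds of real functions -/

/-- A continuous injective real function on an interval is open at interior points. -/
lemma image_Icc_mem_nhds_of_injOn {u : ℝ → ℝ} {a b t : ℝ} (hc : ContinuousOn u (Icc a b))
    (hi : InjOn u (Icc a b)) (ht : t ∈ Ioo a b) : u '' Icc a b ∈ 𝓝 (u t) := by
  have hab : a ≤ b := (ht.1.trans ht.2).le
  have ha : a ∈ Icc a b := left_mem_Icc.2 hab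
  have hb : b ∈ Icc a b := right_mem_Icc.2 hab
  have htI : t ∈ Icc a b := Ioo_subset_Icc_self ht
  rcases hc.strictMonoOn_of_injOn_Icc' hab hi with h | h
  · exact Filter.mem_of_superset (Ioo_mem_nhds (h ha htI ht.1) (h htI hb ht.2))
      (Ioo_subset_Icc_self.trans (intermediate_value_Icc hab hc))
  · exact Filter.mem_of_superset (Ioo_mem_nhds (h htI hb ht.2) (h ha htI ht.1))
      (Ioo_subset_Icc_self.trans (intermediate_value_Icc' hab hc))

lemma exists_fold_of_lt {u : ℝ → ℝ} {p q m : ℝ} (hc : ContinuousOn u (Icc p q))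
    (h : u p = u q) (hm : m ∈ Icc p q) (hlt : u p < u m) :
    ∃ V, IsOpen V ∧ V.Nonempty ∧ V ⊆ Ioo p q ∧ ∀ t ∈ V, ∃ s ∈ Icc p q, s ∉ V ∧ u s = u t := by
  have hpm : p ≤ m := hm.1
  have hmq : m ≤ q := hm.2
  have hcl : ContinuousOn u (Icc p m) := hc.mono (Icc_subset_Icc_right hmq)
  have hcr : ContinuousOn u (Icc m q) := hc.mono (Icc_subset_Icc_left hpm)
  refine ⟨Ioo m q ∩ u ⁻¹' Ioo (u p) (u m),
    (hcr.mono Ioo_subset_Icc_self).isOpen_inter_preimage isOpen_Ioo isOpen_Ioo, ?_,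
    fun t ht => ⟨hpm.trans_lt ht.1.1, ht.1.2⟩, fun t ht => ?_⟩
  · obtain ⟨y, hy⟩ := nonempty_Ioo.2 hlt
    obtain ⟨t, ht, rfl⟩ := intermediate_value_Ioo' hmq hcr (h ▸ hy)
    exact ⟨t, ht, hy⟩
  · obtain ⟨s, hs, hst⟩ := intermediate_value_Ioo hpm hcl ht.2
    exact ⟨s, ⟨hs.1.le, hs.2.le.trans hmq⟩, fun h' => h'.1.1.not_gt hs.2, hst⟩

/-- A continuous real function taking the same value at the ends of an interval has a fold: an
open set of parameters all of whose values are also taken outside that set. -/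
lemma exists_fold {u : ℝ → ℝ} {p q : ℝ} (hpq : p < q) (hc : ContinuousOn u (Icc p q))
    (h : u p = u q) :
    ∃ V, IsOpen V ∧ V.Nonempty ∧ V ⊆ Ioo p q ∧ ∀ t ∈ V, ∃ s ∈ Icc p q, s ∉ V ∧ u s = u t := by
  by_cases hconst : ∀ t ∈ Icc p q, u t = u p
  · exact ⟨Ioo p q, isOpen_Ioo, nonempty_Ioo.2 hpq, subset_rfl, fun t ht =>
      ⟨p, left_mem_Icc.2 hpq.le, left_notMem_Ioo, (hconst t (Ioo_subset_Icc_self ht)).symm⟩⟩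
  · push Not at hconst
    obtain ⟨m, hm, hne⟩ := hconst
    rcases hne.lt_or_gt with hlt | hlt
    · have := exists_fold_of_lt (u := fun t => -u t) hc.neg (by simp [h]) hm (by simpa using hlt)
      simpa using this
    · exact exists_fold_of_lt hc h hm hlt

/-! ### Minimal maps on a space with a free interval -/

section Minimal

variable {X : Type*} [TopologicalSpace X] {f : X → X}

lemma IsMinimalMap.exists_iterate_mem (hmin : IsMinimalMap f) (x : X) {U : Set X} (hU : IsOpen U)
    (hne : U.Nonempty) : ∃ n, f^[n] x ∈ U := by
  obtain ⟨_, hy, n, rfl⟩ := (hmin x).inter_open_nonempty U hU hne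
  exact ⟨n, hy⟩

lemma IsMinimalMap.iterate_ne [T2Space X] [Infinite X] (hmin : IsMinimalMap f) {k : ℕ} (hk : 0 < k) (x : X) :
    f^[k] x ≠ x := by
  intro h
  have hfin : (range fun n : ℕ => f^[n] x).Finite := by
    refine ((Set.finite_lt_nat k).image fun n => f^[n] x).subset ?_
    rintro _ ⟨n, rfl⟩
    exact ⟨n % k, Nat.mod_lt _ hk, IsPeriodicPt.iterate_mod_apply h n⟩
  have := (hmin x).closure_eq
  rw [hfin.isClosed.closure_eq] at this
  exact Set.infinite_univ (this ▸ hfin)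

variable [CompactSpace X]

lemma IsMinimalMap.exists_bound_iterate_mem (hmin : IsMinimalMap f) (hf : Continuous f) {U : Set X}
    (hU : IsOpen U) (hne : U.Nonempty) : ∃ N, ∀ x, ∃ k ≤ N, f^[k] x ∈ U := by
  obtain ⟨t, ht⟩ := isCompact_univ.elim_finite_subcover (fun n : ℕ => f^[n] ⁻¹' U)
    (fun n => hU.preimage (hf.iterate n))
    (fun x _ => mem_iUnion.2 (hmin.exists_iterate_mem x hU hne))
  refine ⟨t.sup id, fun x => ?_⟩
  obtain ⟨k, hk, hx⟩ := mem_iUnion₂.1 (ht (mem_univ x))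
  exact ⟨k, Finset.le_sup (f := id) hk, hx⟩

/-- A minimal map is irreducible: no proper closed subset is mapped onto the whole space.
Otherwise there would be arbitrarily long orbit segments inside this subset. -/
lemma IsMinimalMap.eq_univ_of_image_eq_univ (hmin : IsMinimalMap f) (hf : Continuous f)
    {F : Set X} (hF : IsClosed F) (h : f '' F = univ) : F = univ := by
  by_contra hne
  obtain ⟨N, hN⟩ := hmin.exists_bound_iterate_mem hf hF.isOpen_compl (nonempty_compl.2 hne)
  have key : ∀ m : ℕ, ∃ z, ∀ j ≤ m, f^[j] z ∈ F := by
    intro m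
    induction m with
    | zero =>
      obtain ⟨y, -⟩ := nonempty_compl.2 hne
      obtain ⟨z, hz, -⟩ : y ∈ f '' F := h.symm ▸ mem_univ y
      exact ⟨z, fun j hj => by simpa [Nat.le_zero.1 hj] using hz⟩
    | succ m ih =>
      obtain ⟨z, hz⟩ := ih
      obtain ⟨w, hw, rfl⟩ : z ∈ f '' F := h.symm ▸ mem_univ z
      refine ⟨w, fun j hj => ?_⟩
      cases j with
      | zero => exact hw
      | succ j => exact hz j (by omega)
  obtain ⟨z, hz⟩ := key N
  obtain ⟨k, hk, hk'⟩ := hN z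
  exact hk' (hz k hk)

variable [T2Space X]

lemma IsMinimalMap.eq_univ_of_image_iterate_eq_univ (hmin : IsMinimalMap f) (hf : Continuous f)
    {F : Set X} (hF : IsClosed F) (k : ℕ) (h : f^[k] '' F = univ) : F = univ := by
  induction k with
  | zero => simpa using h
  | succ k ih =>
    refine ih (hmin.eq_univ_of_image_eq_univ hf
      ((hF.isCompact.image (hf.iterate k)).isClosed) ?_)
    rw [← image_comp, ← iterate_succ', h]

lemma IsMinimalMap.surjective (hmin : IsMinimalMap f) (hf : Continuous f) :
    Surjective f := by
  have hcl : IsClosed (range f) := (isCompact_range hf).isClosed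
  intro y
  by_contra hy
  obtain ⟨n, hn⟩ := hmin.exists_iterate_mem (f y) hcl.isOpen_compl ⟨y, hy⟩
  rw [← iterate_succ_apply, iterate_succ_apply'] at hn
  exact hn (mem_range_self _)

/-- Near a point of a free interval, the iterate `f^k` of a minimal map is injective if
it takes values in that interval: a fold would contradict irreducibility. Irreducibility moreover
rules out that points elsewhere have the same value. -/
lemma IsMinimalMap.eq_of_iterate_eq (hmin : IsMinimalMap f) (hf : Continuous f) {φ : ℝ → X}
    (hφ : IsOpenEmbedding φ) {k : ℕ} {t : ℝ} (ht : f^[k] (φ t) ∈ range φ) {z : X}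
    (hz : f^[k] z = f^[k] (φ t)) : z = φ t := by
  have hcont : Continuous fun s => f^[k] (φ s) := (hf.iterate k).comp hφ.continuous
  obtain ⟨ε, hε, hball⟩ : ∃ ε > 0, Icc (t - ε) (t + ε) ⊆ (fun s => f^[k] (φ s)) ⁻¹' range φ := by
    obtain ⟨ε, hε, h⟩ := Metric.nhds_basis_closedBall.mem_iff.1
      (hcont.continuousAt.preimage_mem_nhds (hφ.isOpen_range.mem_nhds ht))
    exact ⟨ε, hε, Real.closedBall_eq_Icc ▸ h⟩
  let e := hφ.toOpenPartialHomeomorph φ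
  have he : ∀ s, e.symm (φ s) = s := fun s => e.left_inv (mem_univ s)
  let u : ℝ → ℝ := fun s => e.symm (f^[k] (φ s))
  have hu : ∀ s ∈ Icc (t - ε) (t + ε), φ (u s) = f^[k] (φ s) := by
    intro s hs
    obtain ⟨r, hr⟩ := hball hs
    simp only [u, ← hr, he]
  have huc : ContinuousOn u (Icc (t - ε) (t + ε)) := by
    refine e.symm.continuousOn.comp hcont.continuousOn fun s hs => ?_
    simpa [e] using hball hs
  have hinj : InjOn u (Icc (t - ε) (t + ε)) := by
    have aux : ∀ p ∈ Icc (t - ε) (t + ε), ∀ q ∈ Icc (t - ε) (t + ε), p < q → u p ≠ u q := by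
      intro p hp q hq hpq h
      have hsub : Icc p q ⊆ Icc (t - ε) (t + ε) := Icc_subset_Icc hp.1 hq.2
      obtain ⟨V, hVo, ⟨v, hv⟩, hVs, hV⟩ := exists_fold hpq (huc.mono hsub) h
      have himg : f^[k] '' (φ '' V)ᶜ = univ := by
        refine eq_univ_of_forall fun y => ?_
        obtain ⟨x, rfl⟩ := (hmin.surjective hf).iterate k y
        by_cases hx : x ∈ φ '' V
        · obtain ⟨r, hr, rfl⟩ := hx
          obtain ⟨s, hs, hsV, hsr⟩ := hV r hr
          refine ⟨φ s, fun ⟨s', hs', he'⟩ => hsV (hφ.injective he' ▸ hs'), ?_⟩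
          rw [← hu s (hsub hs), ← hu r (hsub (Ioo_subset_Icc_self (hVs hr))), hsr]
        · exact ⟨x, hx, rfl⟩
      have := hmin.eq_univ_of_image_iterate_eq_univ hf
        (hφ.isOpenMap V hVo).isClosed_compl k himg
      exact (this ▸ mem_univ (φ v) : φ v ∈ (φ '' V)ᶜ) (mem_image_of_mem _ hv)
    intro p hp q hq h
    rcases lt_trichotomy p q with hpq | hpq | hpq
    · exact (aux p hp q hq hpq h).elim
    · exact hpq
    · exact (aux q hq p hp hpq h.symm).elim
  have htI : t ∈ Ioo (t - ε) (t + ε) := ⟨by linarith, by linarith⟩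
  obtain ⟨W, hWsub, hWo, htW⟩ := mem_nhds_iff.1 (image_Icc_mem_nhds_of_injOn huc hinj htI)
  -- The points outside the arc whose image is near `f^k (φ t)` form an open set, which is
  -- redundant for surjectivity, hence empty.
  let A := φ '' Icc (t - ε) (t + ε)
  have hA : IsClosed A := (isCompact_Icc.image hφ.continuous).isClosed
  let W' := f^[k] ⁻¹' (φ '' W) ∩ Aᶜ
  have hW'o : IsOpen W' :=
    ((hφ.isOpenMap W hWo).preimage (hf.iterate k)).inter hA.isOpen_compl
  have himg : f^[k] '' W'ᶜ = univ := by
    refine eq_univ_of_forall fun y => ?_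
    obtain ⟨x, rfl⟩ := (hmin.surjective hf).iterate k y
    by_cases hx : x ∈ W'
    · obtain ⟨⟨w, hw, hwx⟩, -⟩ := hx
      obtain ⟨s, hs, rfl⟩ := hWsub hw
      exact ⟨φ s, fun h => h.2 (mem_image_of_mem _ hs), by rw [← hu s hs, hwx]⟩
    · exact ⟨x, hx, rfl⟩
  have hzW : z ∉ W' := (hmin.eq_univ_of_image_iterate_eq_univ hf hW'o.isClosed_compl k himg ▸
    mem_univ z : z ∈ W'ᶜ)
  have hzA : z ∈ A := by
    by_contra hzA
    refine hzW ⟨⟨u t, htW, ?_⟩, hzA⟩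
    rw [hz, hu t (Ioo_subset_Icc_self htI)]
  obtain ⟨s, hs, rfl⟩ := hzA
  have : u s = u t := by simp only [u, hz]
  rw [hinj hs (Ioo_subset_Icc_self htI) this]

/-- Every point is `f^j` of a point of a given nonempty open set. -/
lemma IsMinimalMap.exists_iterate_eq (hmin : IsMinimalMap f) (hf : Continuous f) {U : Set X}
    (hU : IsOpen U) (hne : U.Nonempty) (x : X) : ∃ y ∈ U, ∃ j, f^[j] y = x := by
  obtain ⟨N, hN⟩ := hmin.exists_bound_iterate_mem hf hU hne
  obtain ⟨z, rfl⟩ := (hmin.surjective hf).iterate N x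
  obtain ⟨k, hk, hz⟩ := hN z
  exact ⟨_, hz, N - k, by rw [← iterate_add_apply, Nat.sub_add_cancel hk]⟩

lemma IsMinimalMap.injective (hmin : IsMinimalMap f) (hf : Continuous f) {φ : ℝ → X}
    (hφ : IsOpenEmbedding φ) : Injective f := by
  intro x x' h
  obtain ⟨_, ⟨t, rfl⟩, j, rfl⟩ :=
    hmin.exists_iterate_eq hf hφ.isOpen_range (range_nonempty φ) x
  obtain ⟨y, rfl⟩ := (hmin.surjective hf).iterate j x'
  obtain ⟨i, hi⟩ := hmin.exists_iterate_mem (f (f^[j] (φ t))) hφ.isOpen_range (range_nonempty φ)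
  have key : ∀ w, f^[i + 1 + j] w = f^[i] (f (f^[j] w)) := fun w => by
    rw [iterate_add_apply, iterate_succ_apply]
  rw [hmin.eq_of_iterate_eq hf hφ (k := i + 1 + j) (t := t) (z := y) (by rwa [key])
    (by rw [key, key, h])]

/-- A minimal map of a compact Hausdorff space with a free interval is a homeomorphism. -/
lemma IsMinimalMap.isHomeomorph (hmin : IsMinimalMap f) (hf : Continuous f) {φ : ℝ → X}
    (hφ : IsOpenEmbedding φ) : IsHomeomorph f :=
  isHomeomorph_iff_continuous_bijective.2
    ⟨hf, hmin.injective hf hφ, hmin.surjective hf⟩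

end Minimal

lemma IsFreeInterval.exists_isOpenEmbedding {X : Type*} [TopologicalSpace X] {J : Set X}
    (hJ : IsFreeInterval J) : ∃ φ : ℝ → X, IsOpenEmbedding φ := by
  obtain ⟨hJo, I, ⟨c, hc⟩, hIo, -, ⟨h⟩⟩ := hJ
  obtain ⟨r, hr, hball⟩ := Metric.isOpen_iff.1 hIo c hc
  let b := OpenPartialHomeomorph.univBall c r
  have hsrc : b.source = univ := OpenPartialHomeomorph.univBall_source c r
  have hmem : ∀ t, b t ∈ I := fun t => hball <| by
    rw [← OpenPartialHomeomorph.univBall_target c hr]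
    exact b.map_source (hsrc ▸ mem_univ t)
  have hb : IsOpenEmbedding fun t => (⟨b t, hmem t⟩ : I) :=
    .of_comp (g := Subtype.val) _ hIo.isOpenEmbedding_subtypeVal (b.isOpenEmbedding hsrc)
  exact ⟨_, (hJo.isOpenEmbedding_subtypeVal.comp h.symm.isOpenEmbedding).comp hb⟩

/-! ### A clopen circle -/

section Curve

variable {X : Type*} [TopologicalSpace X]

/-- One-dimensional invariance of domain: a locally injective curve in a one-dimensional manifold
covers a neighbourhood of each of its points. -/
lemma range_mem_nhds_of_injOn {F φ : ℝ → X} (hF : Continuous F) (hφ : IsOpenEmbedding φ)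
    {t δ : ℝ} (hδ : 0 < δ) (hinj : InjOn F (Ioo (t - δ) (t + δ))) (ht : F t ∈ range φ) :
    range F ∈ 𝓝 (F t) := by
  have hpre : F ⁻¹' range φ ∩ Ioo (t - δ) (t + δ) ∈ 𝓝 t :=
    Filter.inter_mem (hF.continuousAt.preimage_mem_nhds (hφ.isOpen_range.mem_nhds ht))
      (Ioo_mem_nhds (by linarith) (by linarith))
  obtain ⟨ε, hε, h⟩ := Metric.nhds_basis_closedBall.mem_iff.1 hpre
  rw [Real.closedBall_eq_Icc] at h
  let e := hφ.toOpenPartialHomeomorph φ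
  have he : ∀ y ∈ range φ, φ (e.symm y) = y := by
    rintro _ ⟨s, rfl⟩
    exact congrArg φ (e.left_inv (mem_univ s))
  have huc : ContinuousOn (fun s => e.symm (F s)) (Icc (t - ε) (t + ε)) :=
    e.symm.continuousOn.comp hF.continuousOn fun s hs => by simpa [e] using (h hs).1
  have hui : InjOn (fun s => e.symm (F s)) (Icc (t - ε) (t + ε)) := by
    intro s hs s' hs' hss
    refine hinj (h hs).2 (h hs').2 ?_
    rw [← he _ (h hs).1, ← he _ (h hs').1]
    exact congrArg φ hss
  have hn := image_Icc_mem_nhds_of_injOn huc hui (t := t) ⟨by linarith, by linarith⟩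
  have := hφ.isOpenMap.image_mem_nhds hn
  rw [he _ ht] at this
  refine Filter.mem_of_superset this ?_
  rintro _ ⟨_, ⟨s, hs, rfl⟩, rfl⟩
  exact ⟨s, (he _ (h hs).1).symm⟩

lemma AddCircle.injOn_coe_Ioo {r : ℝ} (hr : 0 < r) (t : ℝ) :
    InjOn ((↑) : ℝ → AddCircle r) (Ioo (t - r / 2) (t + r / 2)) := by
  have : Fact (0 < r) := ⟨hr⟩
  intro a ha b hb h
  have hsub : ∀ x ∈ Ioo (t - r / 2) (t + r / 2), x ∈ Ico (t - r / 2) (t - r / 2 + r) :=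
    fun x hx => ⟨hx.1.le, by linarith [hx.2]⟩
  exact (AddCircle.coe_eq_coe_iff_of_mem_Ico (hsub a ha) (hsub b hb)).1 h

lemma isClopen_range_addCircle [T2Space X] {r : ℝ} (hr : 0 < r) {F : AddCircle r → X}
    (hF : Continuous F) (hinj : Injective F)
    (hX : ∀ x : X, ∃ φ : ℝ → X, IsOpenEmbedding φ ∧ x ∈ range φ) : IsClopen (range F) := by
  have : Fact (0 < r) := ⟨hr⟩
  refine ⟨(isCompact_range hF).isClosed, isOpen_iff_mem_nhds.2 ?_⟩
  rintro _ ⟨c, rfl⟩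
  obtain ⟨t, rfl⟩ := QuotientAddGroup.mk_surjective c
  obtain ⟨φ, hφ, ht⟩ := hX (F (t : AddCircle r))
  refine Filter.mem_of_superset (range_mem_nhds_of_injOn (F := fun s : ℝ => F (s : AddCircle r))
    (hF.comp (AddCircle.continuous_mk' r)) hφ (half_pos hr)
    (hinj.comp_injOn (AddCircle.injOn_coe_Ioo hr t)) ht) ?_
  rintro _ ⟨s, rfl⟩
  exact ⟨_, rfl⟩

/-- If a continuous injective map `g` without fixed points moves the point `φ 0` of a free
interval to the right, it preserves the orientation there. If `g` reversed the orientation, the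
image of `φ t` would for increasing `t` move back along the arc from `φ 0` to `φ 1`
until it met `φ t`. -/
lemma exists_orientation_preserving [T2Space X] {φ : ℝ → X} (hφ : IsOpenEmbedding φ) {g : X → X}
    (hg : Continuous g) (hinj : Injective g) (hfix : ∀ x, g x ≠ x) (h01 : g (φ 0) = φ 1) :
    ∃ ε > 0, ∀ s ∈ Ioo 0 ε, ∃ r > 1, g (φ s) = φ r := by
  have hcont : Continuous fun s => g (φ s) := hg.comp hφ.continuous
  let e := hφ.toOpenPartialHomeomorph φ
  have he : ∀ y ∈ range φ, φ (e.symm y) = y := by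
    rintro _ ⟨s, rfl⟩
    exact congrArg φ (e.left_inv (mem_univ s))
  let u : ℝ → ℝ := fun s => e.symm (g (φ s))
  have hu0 : u 0 = 1 := by
    simp only [u, h01]
    exact e.left_inv (mem_univ 1)
  have huc : ∀ c, (∀ s ∈ Icc 0 c, g (φ s) ∈ range φ) → ContinuousOn u (Icc 0 c) := fun c hc =>
    e.symm.continuousOn.comp hcont.continuousOn fun s hs => by simpa [e] using hc s hs
  have hui : ∀ c, (∀ s ∈ Icc 0 c, g (φ s) ∈ range φ) → InjOn u (Icc 0 c) := by
    intro c hc s hs s' hs' hss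
    refine hφ.injective (hinj ?_)
    rw [← he _ (hc s hs), ← he _ (hc s' hs')]
    exact congrArg φ hss
  obtain ⟨ε, hε, hball⟩ := Metric.nhds_basis_closedBall.mem_iff.1
    (hcont.continuousAt.preimage_mem_nhds (hφ.isOpen_range.mem_nhds (h01 ▸ mem_range_self 1)) :
      (fun s => g (φ s)) ⁻¹' range φ ∈ 𝓝 0)
  have hD : ∀ s ∈ Icc 0 ε, g (φ s) ∈ range φ := fun s hs => hball <| by
    rw [Real.closedBall_eq_Icc]
    exact ⟨by linarith [hs.1], by linarith [hs.2]⟩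
  have h0 : (0 : ℝ) ∈ Icc 0 ε := left_mem_Icc.2 hε.le
  rcases (huc ε hD).strictMonoOn_of_injOn_Icc' hε.le (hui ε hD) with hmono | hanti
  · refine ⟨ε, hε, fun s hs => ⟨u s, ?_, (he _ (hD s (Ioo_subset_Icc_self hs))).symm⟩⟩
    rw [← hu0]
    exact hmono h0 (Ioo_subset_Icc_self hs) hs.1
  exfalso
  have key : ∀ c, (∀ s ∈ Icc 0 c, g (φ s) ∈ range φ) → ∀ s ∈ Icc 0 c, s < u s ∧ u s ≤ 1 := by
    intro c hc s hs
    have hcpos : (0 : ℝ) ≤ c := hs.1.trans hs.2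
    have hantic : StrictAntiOn u (Icc 0 c) := by
      rcases (huc c hc).strictMonoOn_of_injOn_Icc' hcpos (hui c hc) with hm | hm
      · rcases hcpos.eq_or_lt with rfl | hcpos
        · intro x hx y hy hxy
          exact absurd hxy (by linarith [hx.1, hy.2])
        · have hpos : 0 < min c ε := lt_min hcpos hε
          have h1 := hm (left_mem_Icc.2 hcpos.le) ⟨hpos.le, min_le_left _ _⟩ hpos
          have h2 := hanti h0 ⟨hpos.le, min_le_right _ _⟩ hpos
          exact absurd h1 h2.not_gt
      · exact hm
    have hle : u s ≤ 1 := hu0 ▸ hantic.antitoneOn (left_mem_Icc.2 hcpos) hs hs.1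
    refine ⟨?_, hle⟩
    by_contra! hlt
    have hsub : Icc 0 s ⊆ Icc 0 c := Icc_subset_Icc_right hs.2
    obtain ⟨t, ht, ht0⟩ := intermediate_value_Icc' (f := fun t => u t - t) hs.1
      (((huc c hc).mono hsub).sub continuousOn_id) (show (0 : ℝ) ∈ _ by
        exact ⟨sub_nonpos.2 hlt, by simp [hu0]⟩)
    have : u t = t := sub_eq_zero.1 ht0
    exact hfix (φ t) (by rw [← he _ (hc t (hsub ht)), show e.symm (g (φ t)) = t from this])
  have hE : IsCompact (Icc 0 1 ∩ (fun s => g (φ s)) ⁻¹' (range φ)ᶜ) :=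
    isCompact_Icc.inter_right (hφ.isOpen_range.isClosed_compl.preimage hcont)
  rcases (Icc 0 1 ∩ (fun s => g (φ s)) ⁻¹' (range φ)ᶜ).eq_empty_or_nonempty with hempty | hne
  · have := key 1 (fun s hs => by
      by_contra h
      exact (hempty ▸ (⟨hs, h⟩ : s ∈ Icc 0 1 ∩ (fun s => g (φ s)) ⁻¹' (range φ)ᶜ) :
        s ∈ (∅ : Set ℝ))) 1 (right_mem_Icc.2 zero_le_one)
    linarith
  · -- `b` is the first parameter at which `g ∘ φ` leaves the free interval; but before `b`
    -- it stays in the compact arc `φ '' [0, 1]`.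
    obtain ⟨b, ⟨hb, hbD⟩, hbmin⟩ := hE.exists_isLeast hne
    have hb0 : 0 < b := by
      rcases hb.1.eq_or_lt with rfl | h
      · exact (hbD ⟨1, h01.symm⟩).elim
      · exact h
    have hmem : ∀ s ∈ Ico 0 b, g (φ s) ∈ φ '' Icc 0 1 := by
      intro s hs
      have hc : ∀ r ∈ Icc 0 s, g (φ r) ∈ range φ := by
        intro r hr
        by_contra h
        exact absurd (hbmin ⟨⟨hr.1, hr.2.trans (hs.2.le.trans hb.2)⟩, h⟩)
          (hr.2.trans_lt hs.2).not_ge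
      have hk := key s hc s (right_mem_Icc.2 hs.1)
      exact ⟨u s, ⟨hs.1.trans hk.1.le, hk.2⟩, he _ (hc s (right_mem_Icc.2 hs.1))⟩
    have hclosed : IsClosed ((fun s => g (φ s)) ⁻¹' (φ '' Icc 0 1)) :=
      ((isCompact_Icc.image hφ.continuous).isClosed).preimage hcont
    have hbcl : b ∈ closure (Ico 0 b) := by
      rw [closure_Ico hb0.ne]
      exact right_mem_Icc.2 hb0.le
    exact hbD (image_subset_range φ _ (closure_minimal hmem hclosed hbcl))

/-- An arc from `φ 0` to `g (φ 0) = φ 1` in a free interval extends equivariantly to a curve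
`γ : ℝ → X` with `γ (t + 1) = g (γ t)`. It is locally injective because `g` preserves the
orientation at the points where consecutive arcs are joined. -/
lemma exists_equivariant_curve [T2Space X] {φ : ℝ → X} (hφ : IsOpenEmbedding φ) (g : X ≃ₜ X)
    (hfix : ∀ x, g x ≠ x) (h01 : g (φ 0) = φ 1) :
    ∃ γ : ℝ → X, Continuous γ ∧ (∀ (t : ℝ) (n : ℤ), γ (t + n) = (g ^ n) (γ t)) ∧
      (∀ t, ∃ δ > 0, InjOn γ (Ioo (t - δ) (t + δ))) ∧ EqOn γ φ (Ico 0 1) := by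
  obtain ⟨ε, hε, hor⟩ := exists_orientation_preserving hφ g.continuous g.injective hfix h01
  let γ : ℝ → X := fun t => (g ^ ⌊t⌋) (φ (Int.fract t))
  have hγ : ∀ (t : ℝ) (n : ℤ), γ (t + n) = (g ^ n) (γ t) := by
    intro t n
    simp only [γ, Int.floor_add_intCast, Int.fract_add_intCast]
    rw [add_comm, zpow_add]
    rfl
  have hEq : EqOn γ φ (Ico 0 1) := by
    intro t ht
    simp only [γ, Int.floor_eq_zero_iff.2 ht, Int.fract_eq_self.2 ht, zpow_zero]
    rfl
  let β : ℝ → X := fun t => if t ≤ 1 then φ t else g (φ (t - 1))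
  have hβc : Continuous β := Continuous.if_le hφ.continuous
    (g.continuous.comp (hφ.continuous.comp (continuous_id.sub continuous_const)))
    continuous_id continuous_const (by rintro _ rfl; simp [h01])
  have hγβ : EqOn γ β (Ioo 0 2) := by
    intro t ht
    have hg : ∀ s, γ (s + 1) = g (γ s) := fun s => by
      have := hγ s 1
      rwa [Int.cast_one, zpow_one] at this
    rcases lt_trichotomy t 1 with h | rfl | h
    · simp only [β, if_pos h.le]
      exact hEq ⟨ht.1.le, h⟩
    · have := hg 0
      rw [zero_add] at this
      simp only [β, if_pos le_rfl, this, hEq ⟨le_rfl, zero_lt_one⟩, h01]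
    · have := hg (t - 1)
      rw [sub_add_cancel] at this
      simp only [β, if_neg h.not_ge, this]
      rw [hEq ⟨by linarith, by linarith [ht.2]⟩]
  have hβi : InjOn β (Ioo 0 (1 + ε)) := by
    have aux : ∀ s ≤ 1, ∀ t ∈ Ioo 1 (1 + ε), φ s ≠ g (φ (t - 1)) := by
      intro s hs t ht h
      obtain ⟨r, hr, hr'⟩ := hor (t - 1) ⟨by linarith [ht.1], by linarith [ht.2]⟩
      have := hφ.injective (h.trans hr')
      linarith
    intro s hs t ht h
    by_cases hs1 : s ≤ 1 <;> by_cases ht1 : t ≤ 1 <;> simp only [β, hs1, ht1, if_true, if_false] at h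
    · exact hφ.injective h
    · exact (aux s hs1 t ⟨not_le.1 ht1, ht.2⟩ h).elim
    · exact (aux t ht1 s ⟨not_le.1 hs1, hs.2⟩ h.symm).elim
    · have := hφ.injective (g.injective h)
      linarith
  have hshift : ∀ n : ℤ, γ = fun t => (g ^ n) (γ (t - n)) := by
    intro n
    funext t
    rw [← hγ, sub_add_cancel]
  have hint : ∀ t : ℝ, t - ((⌈t⌉ - 1 : ℤ) : ℝ) ∈ Ioc (0 : ℝ) 1 := by
    intro t
    have h1 := Int.le_ceil t
    have h2 := Int.ceil_lt_add_one t
    push_cast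
    constructor <;> linarith
  refine ⟨γ, continuous_iff_continuousAt.2 fun t => ?_, hγ, fun t => ?_, hEq⟩
  · have ht := hint t
    have hat : ContinuousAt γ (t - ((⌈t⌉ - 1 : ℤ) : ℝ)) :=
      (hβc.continuousAt).congr (Filter.eventuallyEq_of_mem
        (Ioo_mem_nhds ht.1 (by linarith [ht.2])) hγβ.symm)
    rw [hshift (⌈t⌉ - 1)]
    exact (g ^ (⌈t⌉ - 1)).continuous.continuousAt.comp
      (ContinuousAt.comp (f := fun s : ℝ => s - ((⌈t⌉ - 1 : ℤ) : ℝ)) hat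
        (continuous_id.sub continuous_const).continuousAt)
  · have ht := hint t
    set n : ℤ := ⌈t⌉ - 1
    obtain ⟨δ, hδ, hsub⟩ := Metric.isOpen_iff.1 (isOpen_Ioo.inter isOpen_Ioo)
      (t - n) (show t - n ∈ Ioo (0 : ℝ) 2 ∩ Ioo 0 (1 + ε) from
        ⟨⟨ht.1, by linarith [ht.2]⟩, ht.1, by linarith [ht.2]⟩)
    rw [Real.ball_eq_Ioo] at hsub
    have hinj : InjOn γ (Ioo (t - n - δ) (t - n + δ)) :=
      (hβi.mono fun s hs => (hsub hs).2).congr fun s hs => (hγβ (hsub hs).1).symm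
    refine ⟨δ, hδ, fun a ha b hb h => ?_⟩
    rw [hshift n] at h
    have := hinj ⟨by linarith [ha.1], by linarith [ha.2]⟩ ⟨by linarith [hb.1], by linarith [hb.2]⟩
      ((g ^ n).injective h)
    linarith

/-- A locally injective equivariant curve that is not injective has a shortest loop, which is
simple. -/
lemma exists_simple_loop [T2Space X] {g : X ≃ₜ X} {γ : ℝ → X} (hc : Continuous γ)
    (hγ : ∀ (t : ℝ) (n : ℤ), γ (t + n) = (g ^ n) (γ t))
    (hloc : ∀ t, ∃ δ > 0, InjOn γ (Ioo (t - δ) (t + δ))) (hni : ¬ Injective γ) :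
    ∃ s r, 0 < r ∧ γ s = γ (s + r) ∧ InjOn γ (Ico s (s + r)) := by
  obtain ⟨a, R, hR, haR⟩ : ∃ a R, 0 < R ∧ γ a = γ (a + R) := by
    simp only [Injective, not_forall] at hni
    obtain ⟨a, b, hab, hne⟩ := hni
    rcases lt_or_gt_of_ne hne with h | h
    · exact ⟨a, b - a, sub_pos.2 h, by rw [add_sub_cancel, hab]⟩
    · exact ⟨b, a - b, sub_pos.2 h, by rw [add_sub_cancel, hab]⟩
  have hfract : ∀ s r, γ s = γ (s + r) → γ (Int.fract s) = γ (Int.fract s + r) := by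
    intro s r h
    have h1 : γ (Int.fract s + ⌊s⌋) = γ (Int.fract s + r + ⌊s⌋) := by
      rw [add_right_comm, Int.fract_add_floor, h]
    rw [hγ, hγ] at h1
    exact (g ^ ⌊s⌋).injective h1
  let K : Set (ℝ × ℝ) := {p | p.1 ∈ Icc 0 1 ∧ p.2 ∈ Icc 0 R ∧ p.2 ≠ 0 ∧ γ p.1 = γ (p.1 + p.2)}
  have hKmem : ∀ s r, 0 < r → r ≤ R → γ s = γ (s + r) → (Int.fract s, r) ∈ K := fun s r h1 h2 h =>
    ⟨⟨Int.fract_nonneg s, (Int.fract_lt_one s).le⟩, ⟨h1.le, h2⟩, h1.ne', hfract s r h⟩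
  -- Local injectivity keeps the nontrivial coincidences away from the diagonal.
  have hKc : IsCompact K := by
    have heq : IsClosed {p : ℝ × ℝ | γ p.1 = γ (p.1 + p.2)} :=
      isClosed_eq (hc.comp continuous_fst) (hc.comp (continuous_fst.add continuous_snd))
    have hcl : IsClosed {p : ℝ × ℝ | p.2 ≠ 0 ∧ γ p.1 = γ (p.1 + p.2)} := by
      rw [← isOpen_compl_iff, isOpen_iff_mem_nhds]
      rintro ⟨s, r⟩ hp
      by_cases hsr : γ s = γ (s + r)
      · have hr : r = 0 := by
          by_contra h
          exact hp ⟨h, hsr⟩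
        subst hr
        obtain ⟨δ, hδ, hi⟩ := hloc s
        have h1 : (fun p : ℝ × ℝ => p.1) ⁻¹' Ioo (s - δ) (s + δ) ∈ 𝓝 (s, (0 : ℝ)) :=
          continuous_fst.continuousAt.preimage_mem_nhds
            (Ioo_mem_nhds (by simp [hδ]) (by simp [hδ]))
        have h2 : (fun p : ℝ × ℝ => p.1 + p.2) ⁻¹' Ioo (s - δ) (s + δ) ∈ 𝓝 (s, (0 : ℝ)) :=
          (continuous_fst.add continuous_snd).continuousAt.preimage_mem_nhds
            (Ioo_mem_nhds (by simp [hδ]) (by simp [hδ]))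
        filter_upwards [h1, h2] with p hp1 hp2 hp3
        exact hp3.1 (by simpa using hi hp1 hp2 hp3.2)
      · filter_upwards [heq.isOpen_compl.mem_nhds hsr] with p hp1 hp2
        exact hp1 hp2.2
    have : K = (Icc 0 1 ×ˢ Icc 0 R) ∩ {p : ℝ × ℝ | p.2 ≠ 0 ∧ γ p.1 = γ (p.1 + p.2)} := by
      ext p
      simp only [K, mem_ofPred_eq, mem_inter_iff, mem_prod, and_assoc]
    rw [this]
    exact (isCompact_Icc.prod isCompact_Icc).inter_right hcl
  obtain ⟨⟨s, r⟩, ⟨-, hr, hr0, hsr⟩, hmin⟩ :=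
    hKc.exists_isMinOn ⟨_, hKmem a R hR le_rfl haR⟩ continuous_snd.continuousOn
  have hr0 : 0 < r := lt_of_le_of_ne hr.1 (Ne.symm hr0)
  refine ⟨s, r, hr0, hsr, ?_⟩
  have aux : ∀ x ∈ Ico s (s + r), ∀ y ∈ Ico s (s + r), x < y → γ x ≠ γ y := by
    intro x hx y hy hxy h
    have hlt : y - x < r := by linarith [hx.1, hy.2]
    have := hmin (hKmem x (y - x) (sub_pos.2 hxy) (hlt.le.trans hr.2)
      (by rw [add_sub_cancel, h]))
    simp only [mem_ofPred_eq] at this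
    linarith
  intro x hx y hy h
  rcases lt_trichotomy x y with hxy | hxy | hxy
  · exact (aux x hx y hy hxy h).elim
  · exact hxy
  · exact (aux y hy x hx hxy h.symm).elim

end Curve

/-- The pigeonhole principle and minimality produce two distinct parameters with the same image:
otherwise the curve would be a wandering line. -/
lemma IsMinimalMap.not_injective_of_equivariant {X : Type*} [TopologicalSpace X] {f : X → X}
    (hmin : IsMinimalMap f) {k : ℕ} (hk : 0 < k) {γ : ℝ → X}
    (hγ : ∀ (t : ℝ) (q : ℕ), γ (t + q) = f^[k * q] (γ t)) (hopen : IsOpen (γ '' Ioo 0 1)) :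
    ¬ Injective γ := by
  intro hinj
  have hne : (γ '' Ioo 0 1).Nonempty := (nonempty_Ioo.2 zero_lt_one).image γ
  -- arbitrarily late visits to the open arc `γ '' Ioo 0 1`
  have hvisit : ∀ N, ∃ m, N < m ∧ f^[m] (γ 0) ∈ γ '' Ioo 0 1 := fun N => by
    obtain ⟨n, hn⟩ := hmin.exists_iterate_mem (f^[N + 1] (γ 0)) hopen hne
    exact ⟨n + (N + 1), by omega, by rwa [iterate_add_apply]⟩
  have hinf : {m | f^[m] (γ 0) ∈ γ '' Ioo 0 1}.Infinite :=
    Set.infinite_of_forall_exists_gt fun N => (hvisit N).imp fun m hm => ⟨hm.2, hm.1⟩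
  obtain ⟨m, hm, m', hm', hne', hmod⟩ := hinf.exists_ne_map_eq_of_mapsTo
    (f := fun m => m % k) (t := {i | i < k}) (fun m _ => Nat.mod_lt m hk) (Set.finite_lt_nat k)
  wlog hlt : m < m' generalizing m m'
  · exact this m' hm' m hm hne'.symm hmod.symm (by omega)
  obtain ⟨q, hq⟩ : k ∣ m' - m := (Nat.modEq_iff_dvd' hlt.le).1 hmod
  obtain ⟨r, hr, hrm⟩ := hm
  obtain ⟨r', hr', hrm'⟩ := hm'
  have hq0 : 1 ≤ q := by
    rcases Nat.eq_zero_or_pos q with rfl | h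
    · omega
    · exact h
  have : γ (r + q) = γ r' := by
    rw [hγ, hrm, hrm', ← iterate_add_apply, ← hq, Nat.sub_add_cancel hlt.le]
  have := hinj this
  have : (1 : ℝ) ≤ q := by exact_mod_cast hq0
  linarith [hr.1, hr'.2]

lemma exists_isOpenEmbedding_map_zero_one {X : Type*} [TopologicalSpace X] {φ : ℝ → X}
    (hφ : IsOpenEmbedding φ) {a b : ℝ} (hab : a ≠ b) :
    ∃ φ' : ℝ → X, IsOpenEmbedding φ' ∧ φ' 0 = φ a ∧ φ' 1 = φ b := by
  refine ⟨fun t => φ ((b - a) * t + a), ?_, by simp, by simp⟩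
  exact hφ.comp (((Homeomorph.mulLeft₀ (b - a) (sub_ne_zero.2 hab.symm)).trans
    (Homeomorph.addRight a)).isOpenEmbedding)

/-- A space with a free interval and a minimal homeomorphism contains a clopen circle. -/
lemma IsMinimalMap.exists_isClopen_circle {X : Type*} [TopologicalSpace X] [T2Space X]
    {f : X ≃ₜ X} (hmin : IsMinimalMap f) {φ : ℝ → X}
    (hφ : IsOpenEmbedding φ) (hX : ∀ x : X, ∃ φ : ℝ → X, IsOpenEmbedding φ ∧ x ∈ range φ) :
    ∃ C : Set X, IsClopen C ∧ IsTopologicalCircle C := by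
  have : Infinite X := Infinite.of_injective φ hφ.injective
  obtain ⟨n, b, hb⟩ := hmin.exists_iterate_mem (f (φ 0)) hφ.isOpen_range (range_nonempty φ)
  rw [← iterate_succ_apply] at hb
  have hb0 : (0 : ℝ) ≠ b := by
    rintro rfl
    exact hmin.iterate_ne n.succ_pos _ hb.symm
  obtain ⟨φ', hφ', h0, h1⟩ := exists_isOpenEmbedding_map_zero_one hφ hb0
  have hpow : ∀ (m : ℕ) (x : X), (f ^ m) x = f^[m] x := by
    intro m x
    induction m with
    | zero => rfl
    | succ m ih => rw [iterate_succ_apply', pow_succ', ← ih]; rfl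
  obtain ⟨γ, hγc, hγ, hloc, hEq⟩ := exists_equivariant_curve hφ' (f ^ (n + 1))
    (fun x => by rw [hpow]; exact hmin.iterate_ne n.succ_pos x) (by rw [hpow, h0, h1, hb])
  have hni : ¬ Injective γ := by
    refine hmin.not_injective_of_equivariant n.succ_pos (γ := γ) (fun t q => ?_) ?_
    · rw [← hpow, pow_mul]
      exact_mod_cast hγ t q
    · rw [(hEq.mono Ioo_subset_Ico_self).image_eq]
      exact hφ'.isOpenMap _ isOpen_Ioo
  obtain ⟨s, r, hr, hsr, hinj⟩ := exists_simple_loop hγc hγ hloc hni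
  have : Fact (0 < r) := ⟨hr⟩
  let F : AddCircle r → X := AddCircle.liftIco r s γ
  have hFc : Continuous F := AddCircle.liftIco_continuous hsr hγc.continuousOn
  have hFi : Injective F := by
    intro x y h
    have hx := (AddCircle.equivIco r s x).2
    have hy := (AddCircle.equivIco r s y).2
    exact (AddCircle.equivIco r s).injective (Subtype.ext (hinj hx hy h))
  refine ⟨range F, isClopen_range_addCircle hr hFc hFi hX, ⟨?_⟩⟩
  exact (hFc.isClosedEmbedding hFi).isEmbedding.toHomeomorph.symm.trans
    (AddCircle.homeomorphAddCircle r 1 hr.ne' one_ne_zero)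

/-! ### Minimal circle maps -/

section CircleMaps

lemma UnitAddCircle.coe_add_intCast (x : ℝ) (n : ℤ) : ((x + n : ℝ) : UnitAddCircle) = x := by
  have : ((n : ℝ) : UnitAddCircle) = 0 := (AddCircle.coe_eq_zero_iff (1 : ℝ)).2 ⟨n, by simp⟩
  rw [AddCircle.coe_add, this, add_zero]

lemma UnitAddCircle.exists_eq_add_intCast {x y : ℝ} (h : (x : UnitAddCircle) = y) :
    ∃ n : ℤ, x = y + n := by
  have h0 : ((x - y : ℝ) : UnitAddCircle) = 0 := by rw [AddCircle.coe_sub, h, sub_self]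
  obtain ⟨n, hn⟩ := (AddCircle.coe_eq_zero_iff (1 : ℝ)).1 h0
  rw [zsmul_one] at hn
  exact ⟨n, by linarith⟩

/-- A continuous injective circle map without fixed points has a lift to the real line of degree
one: a lift of another degree `d` satisfies `Ψ m - m = Ψ 0 + (d - 1) * m` for all integers `m`, so
`Ψ - id` has a zero. -/
lemma exists_circleDeg1Lift {ψ : UnitAddCircle → UnitAddCircle} (hψ : Continuous ψ)
    (hinj : Injective ψ) (hfix : ∀ x, ψ x ≠ x) :
    ∃ F : CircleDeg1Lift, Continuous F ∧ Injective F ∧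
      ∀ x : ℝ, ((F x : ℝ) : UnitAddCircle) = ψ x := by
  obtain ⟨e₀, he₀⟩ := QuotientAddGroup.mk_surjective (ψ ((0 : ℝ) : UnitAddCircle))
  obtain ⟨Ψ, ⟨-, hΨ⟩, -⟩ := (AddCircle.isCoveringMap_coe (1 : ℝ)).existsUnique_continuousMap_lifts
    ⟨fun x : ℝ => ψ (x : UnitAddCircle), hψ.comp (AddCircle.continuous_mk' 1)⟩ 0 e₀ he₀
  have hlift : ∀ x : ℝ, ((Ψ x : ℝ) : UnitAddCircle) = ψ x := fun x => congrFun hΨ x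
  -- the degree of the lift
  obtain ⟨d, hd⟩ : ∃ d : ℤ, ∀ x, Ψ (x + 1) = Ψ x + d := by
    have h1 : ∀ x, ∃ n : ℤ, Ψ (x + 1) = Ψ x + n := fun x => UnitAddCircle.exists_eq_add_intCast <| by
      rw [hlift, hlift]
      have := UnitAddCircle.coe_add_intCast x 1
      rw [Int.cast_one] at this
      rw [this]
    choose n hn using h1
    have hnc : Continuous n := by
      rw [Int.isClosedEmbedding_coe_real.isEmbedding.continuous_iff]
      have : ((↑) : ℤ → ℝ) ∘ n = fun x => Ψ (x + 1) - Ψ x := by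
        funext x
        simp [hn x]
      rw [this]
      fun_prop
    exact ⟨n 0, fun x => by rw [hn x, PreconnectedSpace.constant inferInstance hnc]⟩
  have hdm : ∀ (m : ℕ) (x : ℝ), Ψ (x + m) = Ψ x + d * m := by
    intro m x
    induction m with
    | zero => simp
    | succ m ih =>
      push_cast
      rw [← add_assoc, hd, ih]
      ring
  have hdm' : ∀ (m : ℕ), Ψ (-m) = Ψ 0 - d * m := fun m => by
    have := hdm m (-m)
    rw [neg_add_cancel] at this
    linarith
  have hd1 : d = 1 := by
    by_contra hne
    obtain ⟨m, hm⟩ := exists_nat_ge |Ψ 0|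
    have habs := abs_le.1 hm
    obtain ⟨x, hx⟩ : (0 : ℝ) ∈ range fun x => Ψ x - x := by
      have hp : Ψ m - m = Ψ 0 + (d - 1) * m := by
        have := hdm m 0
        rw [zero_add] at this
        rw [this]
        ring
      have hn : Ψ (-m) - -m = Ψ 0 - (d - 1) * m := by
        rw [hdm']
        ring
      have hm0 : (0 : ℝ) ≤ m := Nat.cast_nonneg m
      rcases lt_or_gt_of_ne hne with h | h
      · have : (d : ℝ) - 1 ≤ -1 := by
          have : (d : ℝ) + 1 ≤ 1 := by exact_mod_cast h
          linarith
        exact mem_range_of_exists_le_of_exists_ge (by fun_prop)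
          ⟨m, by nlinarith⟩ ⟨-m, by nlinarith⟩
      · have : 1 ≤ (d : ℝ) - 1 := by
          have : (1 : ℝ) + 1 ≤ d := by exact_mod_cast h
          linarith
        exact mem_range_of_exists_le_of_exists_ge (by fun_prop)
          ⟨-m, by nlinarith⟩ ⟨m, by nlinarith⟩
    refine hfix (x : UnitAddCircle) ?_
    rw [← hlift, sub_eq_zero.1 hx]
  subst hd1
  simp only [Int.cast_one, one_mul] at hd hdm
  have hΨi : Injective Ψ := by
    have aux : ∀ x y : ℝ, x < y → Ψ x ≠ Ψ y := by
      intro x y hxy h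
      obtain ⟨n, hn⟩ := UnitAddCircle.exists_eq_add_intCast
        (x := y) (y := x) (hinj (by rw [← hlift, ← hlift, h]))
      have hn0 : 0 ≤ n := by
        by_contra! hneg
        have : (n : ℝ) < 0 := by exact_mod_cast hneg
        linarith
      lift n to ℕ using hn0
      have := hdm n x
      rw [Int.cast_natCast] at hn
      rw [← hn, ← h] at this
      linarith
    intro x y h
    rcases lt_trichotomy x y with hxy | hxy | hxy
    · exact (aux x y hxy h).elim
    · exact hxy
    · exact (aux y x hxy h.symm).elim
  have hmono : Monotone Ψ := by
    rcases Ψ.continuous.strictMono_of_inj hΨi with h | h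
    · exact h.monotone
    · have h1 := h zero_lt_one
      have h2 := hd 0
      rw [zero_add] at h2
      linarith
  exact ⟨⟨⟨Ψ, hmono⟩, hd⟩, Ψ.continuous, hΨi, hlift⟩

/-- A minimal injective circle map is conjugate to an irrational rotation. -/
theorem IsMinimalMap.exists_conjugate_rotation {ψ : UnitAddCircle → UnitAddCircle}
    (hmin : IsMinimalMap ψ) (hψ : Continuous ψ) (hinj : Injective ψ) :
    ∃ α : ℝ, Irrational α ∧ TopologicallyConjugate ψ (circleRotation α) := by
  have : Infinite UnitAddCircle :=
    (AddCircle.equivIco (1 : ℝ) 0).infinite_iff.2 (Ico_infinite (by norm_num)).to_subtype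
  obtain ⟨f, hfc, hfi, hf⟩ := exists_circleDeg1Lift hψ hinj (hmin.iterate_ne one_pos)
  have hfb : Bijective f := ⟨hfi, f.continuous_iff_surjective.1 hfc⟩
  have hiter : ∀ (n : ℕ) (x : ℝ), ((f^[n] x : ℝ) : UnitAddCircle) = ψ^[n] x :=
    fun n => (show Semiconj ((↑) : ℝ → UnitAddCircle) f ψ from hf).iterate_right n
  let τ := f.translationNumber
  -- a rational rotation number would yield a periodic point
  have hτ : Irrational τ := by
    rintro ⟨q, hq⟩
    obtain ⟨x, hx⟩ := (f.translationNumber_eq_rat_iff hfc q.pos (m := q.num)).1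
      (by rw [← Rat.cast_def, hq])
    refine hmin.iterate_ne q.pos (x : UnitAddCircle) ?_
    rw [← hiter, ← CircleDeg1Lift.coe_pow, hx, UnitAddCircle.coe_add_intCast]
  have hTb : Bijective (CircleDeg1Lift.translate (Multiplicative.ofAdd τ) : CircleDeg1Lift) :=
    CircleDeg1Lift.isUnit_iff_bijective.1 (Units.isUnit _)
  obtain ⟨F, hF⟩ := CircleDeg1Lift.semiconj_of_bijective_of_translationNumber_eq hfb hTb
    (CircleDeg1Lift.translationNumber_translate τ).symm
  have hFτ : ∀ x, F (f x) = τ + F x := fun x => by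
    rw [hF.eq, CircleDeg1Lift.translate_apply]
  -- The range of `F` is invariant under the dense group generated by `τ` and `1`.
  have hFd : DenseRange F := by
    let S : AddSubgroup ℝ :=
      { carrier := {y | ∀ z, z + y ∈ range F ↔ z ∈ range F}
        zero_mem' := fun z => by rw [add_zero]
        add_mem' := fun {a b} ha hb z => by rw [← add_assoc, hb, ha]
        neg_mem' := fun {a} ha z => by rw [← ha (z + -a), neg_add_cancel_right] }
    have hS : AddSubgroup.closure {τ, 1} ≤ S := by
      rw [AddSubgroup.closure_le]
      rintro y (rfl | rfl) z
      · constructor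
        · rintro ⟨x, hx⟩
          obtain ⟨w, rfl⟩ := hfb.2 x
          exact ⟨w, by rw [hFτ] at hx; linarith⟩
        · rintro ⟨x, rfl⟩
          exact ⟨f x, by rw [hFτ, add_comm]⟩
      · constructor
        · rintro ⟨x, hx⟩
          refine ⟨x - 1, ?_⟩
          have := F.map_sub_int x 1
          rw [Int.cast_one] at this
          rw [this, hx, add_sub_cancel_right]
        · rintro ⟨x, rfl⟩
          exact ⟨x + 1, F.map_add_one x⟩
    have hdense : Dense (AddSubgroup.closure {τ, 1} : Set ℝ) :=
      dense_addSubgroupClosure_pair_iff.2 (by rwa [div_one])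
    have := (Homeomorph.addLeft (F 0)).surjective.denseRange.dense_image
      (Homeomorph.addLeft (F 0)).continuous hdense
    refine this.mono ?_
    rintro _ ⟨y, hy, rfl⟩
    exact (hS hy (F 0)).2 (mem_range_self 0)
  have hFc : Continuous F := F.monotone.continuous_of_denseRange hFd
  have hFs : Surjective F := F.continuous_iff_surjective.1 hFc
  have hFiter : ∀ (n : ℕ) (x : ℝ), F (f^[n] x) = F x + n * τ := by
    intro n x
    induction n with
    | zero => simp
    | succ n ih =>
      rw [iterate_succ_apply', hFτ, ih]
      push_cast
      ring
  -- An interval on which `F` is constant would project to a wandering arc.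
  have hFi : Injective F := by
    have aux : ∀ x y : ℝ, x < y → F x ≠ F y := by
      intro x y hxy h
      have hconst : ∀ t ∈ Ioo x y, F t = F x := fun t ht =>
        le_antisymm ((F.monotone ht.2.le).trans h.ge) (F.monotone ht.1.le)
      obtain ⟨t, ht⟩ := nonempty_Ioo.2 hxy
      have hU : IsOpen (((↑) : ℝ → UnitAddCircle) '' Ioo x y) :=
        QuotientAddGroup.isOpenMap_coe _ isOpen_Ioo
      obtain ⟨n, t', ht', hn⟩ := hmin.exists_iterate_mem (ψ (t : UnitAddCircle)) hU ⟨_, t, ht, rfl⟩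
      rw [← iterate_succ_apply, ← hiter] at hn
      obtain ⟨m, hm⟩ := UnitAddCircle.exists_eq_add_intCast hn
      have h1 : F t' = F t + (n + 1 : ℕ) * τ + m := by
        rw [hm, F.map_add_int, hFiter]
      rw [hconst t ht, hconst t' ht'] at h1
      have h2 : ((n + 1 : ℕ) : ℝ) * τ = ((-m : ℤ) : ℝ) := by
        rw [Int.cast_neg]
        linarith
      exact (hτ.natCast_mul n.succ_ne_zero).ne_int _ h2
    intro x y h
    rcases lt_trichotomy x y with hxy | hxy | hxy
    · exact (aux x y hxy h).elim
    · exact hxy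
    · exact (aux y x hxy h.symm).elim
  have hperF : Periodic (fun x : ℝ => ((F x : ℝ) : UnitAddCircle)) 1 := fun x => by
    have := UnitAddCircle.coe_add_intCast (F x) 1
    rw [Int.cast_one] at this
    simp only [F.map_add_one, this]
  let H : UnitAddCircle → UnitAddCircle := hperF.lift
  have hH : ∀ x : ℝ, H (x : UnitAddCircle) = ((F x : ℝ) : UnitAddCircle) := fun x =>
    hperF.lift_coe x
  have hHc : Continuous H := by
    rw [(QuotientAddGroup.isQuotientMap_mk (N := AddSubgroup.zmultiples (1 : ℝ))).continuous_iff]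
    exact (AddCircle.continuous_mk' 1).comp hFc
  have hHb : Bijective H := by
    constructor
    · intro a b hab
      obtain ⟨x, rfl⟩ := QuotientAddGroup.mk_surjective a
      obtain ⟨y, rfl⟩ := QuotientAddGroup.mk_surjective b
      have hab : H (x : UnitAddCircle) = H (y : UnitAddCircle) := hab
      rw [hH, hH] at hab
      obtain ⟨n, hn⟩ := UnitAddCircle.exists_eq_add_intCast hab
      rw [← F.map_add_int] at hn
      rw [hFi hn]
      exact UnitAddCircle.coe_add_intCast y n
    · intro b
      obtain ⟨y, rfl⟩ := QuotientAddGroup.mk_surjective b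
      obtain ⟨x, rfl⟩ := hFs y
      exact ⟨(x : UnitAddCircle), hH x⟩
  obtain ⟨h, hh⟩ := isHomeomorph_iff_exists_homeomorph.1
    (isHomeomorph_iff_continuous_bijective.2 ⟨hHc, hHb⟩)
  refine ⟨τ, hτ, h, fun a => ?_⟩
  obtain ⟨x, rfl⟩ := QuotientAddGroup.mk_surjective a
  rw [hh]
  change H (ψ (x : UnitAddCircle)) = H (x : UnitAddCircle) + _
  rw [← hf, hH, hH, hFτ, add_comm, AddCircle.coe_add]

end CircleMaps

/-! ### The cycle of circles -/

section Cycle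

variable {X : Type*} [TopologicalSpace X]

lemma IsTopologicalCircle.isConnected {C : Set X} (hC : IsTopologicalCircle C) : IsConnected C := by
  obtain ⟨h⟩ := hC
  have : IsConnected (range fun x : ℝ => (h.symm (x : UnitAddCircle) : X)) :=
    isConnected_range (continuous_subtype_val.comp
      (h.symm.continuous.comp (AddCircle.continuous_mk' 1)))
  convert this
  ext x
  constructor
  · intro hx
    obtain ⟨t, ht⟩ := QuotientAddGroup.mk_surjective (h ⟨x, hx⟩)
    refine ⟨t, ?_⟩
    simp only
    rw [show (t : UnitAddCircle) = h ⟨x, hx⟩ from ht, h.symm_apply_apply]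
  · rintro ⟨t, rfl⟩
    exact Subtype.coe_prop _

lemma IsClopen.eq_of_inter_nonempty {A B : Set X} (hA : IsClopen A) (hB : IsClopen B)
    (hA' : IsConnected A) (hB' : IsConnected B) (h : (A ∩ B).Nonempty) : A = B :=
  (hA'.isPreconnected.subset_isClopen hB h).antisymm
    (hB'.isPreconnected.subset_isClopen hA (inter_comm A B ▸ h))

/-- The images of a clopen connected set under a minimal homeomorphism form a finite cycle. -/
lemma IsMinimalMap.exists_cycle [CompactSpace X] [T2Space X] {f : X ≃ₜ X} (hmin : IsMinimalMap f)
    {C : Set X} (hC : IsClopen C) (hC' : IsConnected C) :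
    ∃ n > 0, f^[n] '' C = C ∧ (∀ m, (f^[m] '' C ∩ C).Nonempty → n ∣ m) ∧
      (∀ i < n, ∀ j < n, i ≠ j → Disjoint (f^[i] '' C) (f^[j] '' C)) ∧
      ∀ x, ∃ i < n, x ∈ f^[i] '' C := by
  classical
  have hclopen : ∀ m, IsClopen (f^[m] '' C) := by
    intro m
    induction m with
    | zero => simpa
    | succ m ih =>
      rw [iterate_succ', image_comp]
      exact ⟨f.isClosedMap _ ih.1, f.isOpenMap _ ih.2⟩
  have hconn : ∀ m, IsConnected (f^[m] '' C) := fun m =>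
    hC'.image _ (f.continuous.iterate m).continuousOn
  have hmeet : ∀ m, (f^[m] '' C ∩ C).Nonempty → f^[m] '' C = C := fun m =>
    (hclopen m).eq_of_inter_nonempty hC (hconn m) hC'
  have hex : ∃ n, 0 < n ∧ f^[n] '' C = C := by
    obtain ⟨x, hx⟩ := hC'.nonempty
    obtain ⟨n, hn⟩ := hmin.exists_iterate_mem (f x) hC.isOpen ⟨x, hx⟩
    exact ⟨n + 1, n.succ_pos, hmeet _ ⟨_, ⟨x, hx, rfl⟩, hn⟩⟩
  obtain ⟨hn0, hn⟩ := Nat.find_spec hex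
  set n := Nat.find hex
  have hmod : ∀ m, f^[m % n] '' C = f^[m] '' C := by
    have : Periodic (fun m => f^[m] '' C) n := fun m => by
      simp only [iterate_add, image_comp, hn]
    exact this.map_mod_nat
  have hdvd : ∀ m, f^[m] '' C = C → n ∣ m := by
    intro m hm
    by_contra h
    have hpos : 0 < m % n := Nat.pos_of_ne_zero fun h0 => h (Nat.dvd_of_mod_eq_zero h0)
    exact Nat.find_min hex (Nat.mod_lt m hn0) ⟨hpos, by rw [hmod, hm]⟩
  have hdisj : ∀ i < n, ∀ j < n, i < j → Disjoint (f^[i] '' C) (f^[j] '' C) := by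
    intro i hi j hj hij
    by_contra h
    have heq := (hclopen i).eq_of_inter_nonempty (hclopen j) (hconn i) (hconn j)
      (not_disjoint_iff_nonempty_inter.1 h)
    rw [← Nat.add_sub_cancel' hij.le, iterate_add, image_comp] at heq
    have := Nat.le_of_dvd (Nat.sub_pos_of_lt hij)
      (hdvd _ ((f.injective.iterate i).image_injective heq).symm)
    omega
  refine ⟨n, hn0, hn, fun m hm => hdvd m (hmeet m hm), fun i hi j hj hij => ?_, fun x => ?_⟩
  · rcases lt_or_gt_of_ne hij with h | h
    · exact hdisj i hi j hj h
    · exact (hdisj j hj i hi h).symm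
  · obtain ⟨y, hy, j, rfl⟩ := hmin.exists_iterate_eq f.continuous hC.isOpen hC'.nonempty x
    exact ⟨j % n, Nat.mod_lt j hn0, hmod j ▸ mem_image_of_mem _ hy⟩

/-- If a point of the open set `C` can only return to `C` at times divisible by `n`, the
restriction of `f^n` to `C` inherits minimality. -/
lemma IsMinimalMap.restrict_iterate {f : X → X} (hmin : IsMinimalMap f) {C : Set X}
    (hC : IsOpen C) {n : ℕ} (hn : MapsTo f^[n] C C)
    (hret : ∀ m, (f^[m] '' C ∩ C).Nonempty → n ∣ m) :
    IsMinimalMap (hn.restrict f^[n] C C) := by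
  intro x
  rw [dense_iff_inter_open]
  intro U hU hne
  obtain ⟨m, y, hy, hym⟩ := hmin.exists_iterate_mem (x : X)
    (hC.isOpenEmbedding_subtypeVal.isOpenMap U hU) (hne.image _)
  obtain ⟨k, rfl⟩ := hret m ⟨f^[m] x, mem_image_of_mem _ x.2, hym ▸ y.2⟩
  refine ⟨y, hy, k, Subtype.ext ?_⟩
  simp only [MapsTo.coe_iterate_restrict]
  rw [← iterate_mul, hym]

end Cycle

lemma TopologicallyConjugate.trans {X Y Z : Type*} [TopologicalSpace X] [TopologicalSpace Y]
    [TopologicalSpace Z] {f : X → X} {g : Y → Y} {k : Z → Z} (h : TopologicallyConjugate f g)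
    (h' : TopologicallyConjugate g k) : TopologicallyConjugate f k := by
  obtain ⟨a, ha⟩ := h
  obtain ⟨b, hb⟩ := h'
  exact ⟨a.trans b, hb.comp_left ha⟩

theorem theoremA {X : Type*} [TopologicalSpace X] [CompactSpace X]
    [TopologicalSpace.MetrizableSpace X] (J : Set X) (hJ : IsFreeInterval J)
    (f : X → X) (hf : Continuous f) (hmin : IsMinimalMap f) :
    ∃ n : ℕ, 0 < n ∧ ∃ C : ZMod n → Set X,
      (∀ i, IsClopen (C i)) ∧
      (∀ i, IsTopologicalCircle (C i)) ∧
      Pairwise (fun i j => Disjoint (C i) (C j)) ∧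
      (⋃ i, C i) = univ ∧
      (∀ i, f '' C i = C (i + 1)) ∧
      ∃ α : ℝ, Irrational α ∧
        ∀ i, ∃ hi : MapsTo f^[n] (C i) (C i),
          TopologicallyConjugate (hi.restrict f^[n] (C i) (C i)) (circleRotation α) := by
  obtain ⟨φ, hφ⟩ := hJ.exists_isOpenEmbedding
  obtain ⟨f, rfl⟩ := isHomeomorph_iff_exists_homeomorph.1 (hmin.isHomeomorph hf hφ)
  have hpow : ∀ m : ℕ, ∃ e : X ≃ₜ X, ⇑e = f^[m] := by
    intro m
    induction m with
    | zero => exact ⟨.refl X, rfl⟩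
    | succ m ih =>
      obtain ⟨e, he⟩ := ih
      exact ⟨e.trans f, by rw [iterate_succ', ← he]; rfl⟩
  choose e he using hpow
  have hX : ∀ x : X, ∃ φ : ℝ → X, IsOpenEmbedding φ ∧ x ∈ range φ := by
    intro x
    obtain ⟨_, ⟨t, rfl⟩, j, rfl⟩ :=
      hmin.exists_iterate_eq hf hφ.isOpen_range (range_nonempty φ) x
    exact ⟨_, (e j).isOpenEmbedding.comp hφ, t, by simp [he]⟩
  obtain ⟨C, hC, hcirc⟩ := hmin.exists_isClopen_circle hφ hX
  obtain ⟨n, hn0, hn, hret, hdisj, hcover⟩ := hmin.exists_cycle hC hcirc.isConnected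
  have : NeZero n := ⟨hn0.ne'⟩
  have hper : Periodic (fun m => f^[m] '' C) n := fun m => by
    simp only [iterate_add, image_comp, hn]
  have hmaps : ∀ m, MapsTo f^[n] (f^[m] '' C) (f^[m] '' C) := by
    intro m
    rw [mapsTo_iff_image_subset, ← image_comp, ← iterate_add, add_comm]
    exact (hper m).subset
  have hmaps0 : MapsTo f^[n] C C := by
    rw [mapsTo_iff_image_subset, hn]
  obtain ⟨h⟩ := id hcirc
  -- the return map in a circle coordinate
  let R : C → C := hmaps0.restrict f^[n] C C
  have hRc : Continuous R := (hf.iterate n).continuousOn.mapsToRestrict hmaps0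
  have hRi : Injective R := hmaps0.restrict_inj.2 (f.injective.iterate n).injOn
  have hRmin : IsMinimalMap R := hmin.restrict_iterate hC.isOpen hmaps0 hret
  have hsemi : Semiconj h R (h ∘ R ∘ h.symm) := fun x => by simp
  have hψmin : IsMinimalMap (h ∘ R ∘ h.symm) := by
    intro y
    obtain ⟨x, rfl⟩ := h.surjective y
    have := h.surjective.denseRange.dense_image h.continuous (hRmin x)
    rw [← range_comp] at this
    refine this.mono ?_
    rintro _ ⟨m, rfl⟩
    exact ⟨m, ((hsemi.iterate_right m) x).symm⟩
  obtain ⟨α, hα, hconj⟩ := hψmin.exists_conjugate_rotation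
    (h.continuous.comp (hRc.comp h.symm.continuous))
    (h.injective.comp (hRi.comp h.symm.injective))
  have hR : TopologicallyConjugate R (circleRotation α) := .trans ⟨h, hsemi⟩ hconj
  refine ⟨n, hn0, fun i => f^[i.val] '' C, fun i => ?_, fun i => ?_, fun i j hij => ?_, ?_,
    fun i => ?_, α, hα, fun i => ⟨hmaps _, ?_⟩⟩
  · simp only [← he]
    exact ⟨(e _).isClosedMap _ hC.1, (e _).isOpenMap _ hC.2⟩
  · simp only [← he]
    exact ⟨((e _).image C).symm.trans h⟩
  · exact hdisj _ i.val_lt _ j.val_lt fun h => hij (ZMod.val_injective n h)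
  · refine eq_univ_of_forall fun x => ?_
    obtain ⟨i, hi, hx⟩ := hcover x
    refine mem_iUnion.2 ⟨(i : ZMod n), ?_⟩
    rwa [ZMod.val_natCast_of_lt hi]
  · have h1 : (i + 1).val = (i.val + 1) % n := by
      rw [ZMod.val_add, ZMod.val_one_eq_one_mod, Nat.add_mod_mod]
    simp only [h1]
    rw [← image_comp, ← iterate_succ']
    exact (hper.map_mod_nat (i.val + 1)).symm
  · refine .trans ?_ hR
    have key : ∀ (k : X ≃ₜ X) (K : Set X) (hk : MapsTo f^[n] K K), K = k '' C →
        (∀ x, f^[n] (k x) = k (f^[n] x)) → TopologicallyConjugate (hk.restrict f^[n] K K) R := by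
      rintro k _ hk rfl hcomm
      refine ⟨(k.image C).symm, ?_⟩
      rintro ⟨_, x, hx, rfl⟩
      have hkx : (k.image C).symm ⟨k x, mem_image_of_mem k hx⟩ = ⟨x, hx⟩ :=
        (k.image C).symm_apply_eq.2 rfl
      rw [hkx]
      exact (k.image C).symm_apply_eq.2 (Subtype.ext (hcomm x))
    refine key (e i.val) _ _ (by rw [he]) fun x => ?_
    rw [he, ← iterate_add_apply, ← iterate_add_apply, add_comm]
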